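/- Let $M$ be a smooth manifold of dimension $d\ge 3$ with a conformal structure $c$ of any signature, i.e. an equivalence class of smooth pseudo-Riemannian metrics under $g\sim e^{2\Upsilon}g$, $\Upsilon\in C^\infty(M)$. For $w\in\mathbb C$ let $\mathcal E[w]$ be the bundle of (complex) conformal densities of weight $w$: a section is a family of smooth functions $f_g$, $g\in c$, with $f_{e^{2\Upsilon}g}=e^{w\Upsilon}f_g$. Let $\mathcal T$ be the standard tractor bundle: for each $g\in c$, $\mathcal T\cong_g\mathcal E[1]\oplus T^*M[1]\oplus\mathcal E[-1]$, where for $\hat g=e^{2\Upsilon}g$ the triples are related by $(\hat\sigma,\hat\mu_b,\hat\rho)=(\sigma,\ \mu_b+\sigma\Upsilon_b,\ \rho-g^{cd}\Upsilon_c\mu_d-\tfrac12\sigma g^{cd}\Upsilon_c\Upsilon_d)$, $\Upsilon_a=\nabla_a\Upsilon$. It carries the tractor metric $h(T,T)=g^{ab}\mu_a\mu_b+2\sigma\rho$ and the tractor connection $\nabla_a(\sigma,\mu_b,\rho)=(\nabla_a\sigma-\mu_a,\ \nabla_a\mu_b+g_{ab}\rho+P_{ab}\sigma,\ \nabla_a\rho-P_{ac}\mu^c)$,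 where $P_{ab}$ is the Schouten tensor of $g$, $\mathrm{Ric}_{ab}=(d-2)P_{ab}+Jg_{ab}$, $J=g^{ab}P_{ab}$. For a tractor bundle $\mathcal E^\Phi$ (a tensor power of $\mathcal T$, or a tensor part of one) put $\mathcal E^\Phi[w]=\mathcal E^\Phi\otimes\mathcal E[w]$; the weight operator $\mathbf w$ is multiplication by $w$ on sections of $\mathcal E^\Phi[w]$. The Thomas operator $D_A$ from sections of $\mathcal E^\Phi[w]$ to sections of $\mathcal T\otimes\mathcal E^\Phi[w-1]$ is given in the scale $g$ by $$D_AV=\big((d+2w-2)\,wV,\ (d+2w-2)\nabla_aV,\ -(\Delta V+wJV)\big),\qquad \Delta=g^{ab}\nabla_a\nabla_b,$$ with $\nabla$ the coupled Levi-Civita–tractor connection. Let $\sigma$ be a section of $\mathcal E[1]$, let $I_A=\frac1d D_A\sigma$ be its scale tractor, $I^2=I^AI_A$ (the square for $h$), and $I\cdot D=I^AD_A$, which maps sections of $\mathcal E^\Phi[w]$ to sections of $\mathcal E^\Phi[w-1]$. (i) If $I^2$ is nowhere zero, then the operators $x=\sigma$ (multiplication by $\sigma$), $y=-\frac1{I^2}\,I\cdot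 D$ and $h=d+2\mathbf w$ on sections of weighted tractor bundles $\mathcal E^\Phi[w]$ ($w\in\mathbb C$) satisfy $$[h,x]=2x,\qquad [h,y]=-2y,\qquad [x,y]=h,$$ the relations of standard $\mathfrak{sl}(2)$ generators. (ii) If $I^2=0$ identically, then with the same $x$ and $h$, and with $y=-I\cdot D$, $$[h,x]=2x,\qquad [h,y]=-2y,\qquad [x,y]=0,$$ an Inönü–Wigner contraction of $\mathfrak{sl}(2)$. -/

import Mathlib

open scoped Manifold ContDiff

noncomputable section

namespace ConformalTractor

/-! ## Local coordinate formulas -/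

section Coordinates

variable {d : ℕ} {H : Type*} [TopologicalSpace H]

/-- The partial derivative `∂_a F` at `u`, for a function of the coordinates `u ∈ ℝ^d`.
It is taken within the range of the model (all of `ℝ^d` for a manifold without boundary,
a half space for a manifold with boundary). -/
def pd (I : ModelWithCorners ℝ (EuclideanSpace ℝ (Fin d)) H)
    {V : Type*} [NormedAddCommGroup V] [NormedSpace ℝ V]
    (a : Fin d) (F : EuclideanSpace ℝ (Fin d) → V) (u : EuclideanSpace ℝ (Fin d)) : V :=
  fderivWithin ℝ F (Set.range I) u (EuclideanSpace.single a 1)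

variable (I : ModelWithCorners ℝ (EuclideanSpace ℝ (Fin d)) H)
  (G : EuclideanSpace ℝ (Fin d) → Matrix (Fin d) (Fin d) ℝ) (u : EuclideanSpace ℝ (Fin d))

/-- Christoffel symbols `Γ^c_{ab}` of the Levi-Civita connection of the metric `G_{ab}`. -/
def christoffel (c a b : Fin d) : ℝ :=
  (1 / 2) * ∑ e, (G u)⁻¹ c e *
    (pd I a (fun v => G v b e) u + pd I b (fun v => G v a e) u - pd I e (fun v => G v a b) u)

/-- `R_{ab}{}^c{}_e`, with `R(X,Y)Z = ∇_X ∇_Y Z - ∇_Y ∇_X Z - ∇_{[X,Y]} Z`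
and `R(X,Y)Z = X^a Y^b Z^e R_{ab}{}^c{}_e`. -/
def riemann (a b c e : Fin d) : ℝ :=
  pd I a (fun v => christoffel I G v c b e) u - pd I b (fun v => christoffel I G v c a e) u
    + ∑ f, (christoffel I G u c a f * christoffel I G u f b e
        - christoffel I G u c b f * christoffel I G u f a e)

/-- `Ric_{ab} = R_{ca}{}^c{}_b`. -/
def ricci (a b : Fin d) : ℝ := ∑ c, riemann I G u c a c b

/-- The scalar curvature `Sc = g^{ab} Ric_{ab}`. -/
def scalarCurvature : ℝ := ∑ a, ∑ b, (G u)⁻¹ a b * ricci I G u a b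

/-- The trace `J = g^{ab} P_{ab}` of the Schouten tensor, `J = Sc / (2 (d - 1))`. -/
def schoutenTrace : ℝ := scalarCurvature I G u / (2 * ((d : ℝ) - 1))

/-- The Schouten tensor `P_{ab}`, determined by `Ric_{ab} = (d - 2) P_{ab} + J g_{ab}`. -/
def schouten (a b : Fin d) : ℝ :=
  (ricci I G u a b - schoutenTrace I G u * G u a b) / ((d : ℝ) - 2)

/-- Index set of the `d + 2` components of a standard tractor `(σ, μ_a, ρ)`:
the top slot `σ`, the slots `μ_a`, and the bottom slot `ρ`. -/
abbrev TIdx (d : ℕ) : Type := Unit ⊕ Fin d ⊕ Unit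

/-- The matrix of the standard tractor connection coupled to the Levi-Civita connection:
`(∇_a T)_B = ∂_a T_B + ∑_C (tractorConn a B C) T_C`, that is
`∇_a (σ, μ_b, ρ) = (∂_a σ - μ_a, ∇_a μ_b + g_{ab} ρ + P_{ab} σ, ∂_a ρ - P_{ac} μ^c)`. -/
def tractorConn (a : Fin d) : TIdx d → TIdx d → ℝ
  | .inl _, .inl _ => 0
  | .inl _, .inr (.inl c) => if c = a then -1 else 0
  | .inl _, .inr (.inr _) => 0
  | .inr (.inl b), .inl _ => schouten I G u a b
  | .inr (.inl b), .inr (.inl c) => - christoffel I G u c a b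
  | .inr (.inl b), .inr (.inr _) => G u a b
  | .inr (.inr _), .inl _ => 0
  | .inr (.inr _), .inr (.inl c) => - ∑ e, schouten I G u a e * (G u)⁻¹ e c
  | .inr (.inr _), .inr (.inr _) => 0

/-- The (inverse) tractor metric `h^{AB}` on the components `(σ, μ_a, ρ)`, where `N = (g^{ab})`:
`h(T, T') = σ ρ' + ρ σ' + g^{ab} μ_a μ'_b`. -/
def tractorMetric (N : Matrix (Fin d) (Fin d) ℝ) : TIdx d → TIdx d → ℝ
  | .inl _, .inr (.inr _) => 1
  | .inr (.inr _), .inl _ => 1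
  | .inr (.inl a), .inr (.inl b) => N a b
  | _, _ => 0

variable {k : ℕ} (F : EuclideanSpace ℝ (Fin d) → (Fin k → TIdx d) → ℂ)

/-- The tractor connection on the components `F_{B_1 … B_k}` of a tractor tensor of rank `k`. In the
trivialisation of the density bundles given by the metric, weights contribute no further term. -/
def nabla (a : Fin d) (B : Fin k → TIdx d) : ℂ :=
  pd I a (fun v => F v B) u
    + ∑ i, ∑ C, (tractorConn I G u a (B i) C : ℂ) * F u (Function.update B i C)

/-- The Laplacian `Δ F = g^{ab} ∇_a ∇_b F` of the coupled Levi-Civita–tractor connection. -/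
def laplacian (B : Fin k → TIdx d) : ℂ :=
  ∑ a, ∑ b, ((G u)⁻¹ a b : ℂ) *
    (nabla I G u (fun v => nabla I G v F b) a B
      - ∑ c, (christoffel I G u c a b : ℂ) * nabla I G u F c B)

/-- The components `(D_A F)_{B_1 … B_k}` of the Thomas D-operator on weight `w`; the new index `A` is
the `0`-th index of the result:
`D F = ((d + 2w - 2) w F, (d + 2w - 2) ∇_a F, -(Δ F + w J F))`. -/
def thomasDComp (w : ℂ) (A : Fin (k + 1) → TIdx d) : ℂ :=
  match A 0 with
  | .inl _ => ((d : ℂ) + 2 * w - 2) * w * F u (Fin.tail A)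
  | .inr (.inl a) => ((d : ℂ) + 2 * w - 2) * nabla I G u F a (Fin.tail A)
  | .inr (.inr _) =>
      -(laplacian I G u F (Fin.tail A) + w * (schoutenTrace I G u : ℂ) * F u (Fin.tail A))

end Coordinates

/-! ## Conformal manifolds -/

section Manifold

variable {d : ℕ} {H : Type*} [TopologicalSpace H]
  (I : ModelWithCorners ℝ (EuclideanSpace ℝ (Fin d)) H)
  {M : Type*} [TopologicalSpace M] [ChartedSpace H M]

/-- The coordinate vector field `∂_a` of the chart at `p`, at the point with coordinates `u`. -/
def coordVec (p : M) (u : EuclideanSpace ℝ (Fin d)) (a : Fin d) :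
    TangentSpace I ((extChartAt I p).symm u) :=
  mfderivWithin 𝓘(ℝ, EuclideanSpace ℝ (Fin d)) I (extChartAt I p).symm (Set.range I) u
    (EuclideanSpace.single a 1 : EuclideanSpace ℝ (Fin d))

variable (M) in
/-- A smooth pseudo-Riemannian metric, of any signature. -/
structure PseudoRiemannianMetric where
  val : ∀ p : M, LinearMap.BilinForm ℝ (TangentSpace I p)
  symm : ∀ p X Y, val p X Y = val p Y X
  nondegenerate : ∀ p X, (∀ Y, val p X Y = 0) → X = 0
  smooth : ∀ (p : M) (a b : Fin d), ContDiffOn ℝ ∞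
    (fun u => val ((extChartAt I p).symm u) (coordVec I p u a) (coordVec I p u b))
    (extChartAt I p).target

/-- `g' = e^{2Υ} g`. -/
def IsRescaling {I : ModelWithCorners ℝ (EuclideanSpace ℝ (Fin d)) H}
    (g g' : PseudoRiemannianMetric I M) (Υ : M → ℝ) : Prop :=
  ContMDiff I 𝓘(ℝ, ℝ) ∞ Υ ∧ ∀ p X Y, g'.val p X Y = Real.exp (2 * Υ p) * g.val p X Y

variable (M) in
/-- A conformal structure `c`: an equivalence class of metrics under `g ∼ e^{2Υ} g`. -/
structure ConformalStructure where
  metrics : Set (PseudoRiemannianMetric I M)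
  nonempty : metrics.Nonempty
  mem_iff : ∀ g ∈ metrics, ∀ g', g' ∈ metrics ↔ ∃ Υ : M → ℝ, IsRescaling g g' Υ

/-- The matrix `g_{ab}` of a metric in the chart at `p`. -/
def chartMetric {I : ModelWithCorners ℝ (EuclideanSpace ℝ (Fin d)) H}
    (g : PseudoRiemannianMetric I M) (p : M) (u : EuclideanSpace ℝ (Fin d)) :
    Matrix (Fin d) (Fin d) ℝ :=
  Matrix.of fun a b => g.val ((extChartAt I p).symm u) (coordVec I p u a) (coordVec I p u b)

/-! ## Tractors -/

/-- The fibre at `p` of (the complexification of) the `k`-th tensor power of the standard tractor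
bundle, as seen in a scale `g ∈ c`. In such a scale the standard tractor bundle is
`ℂ ⊕ T*M ⊗ ℂ ⊕ ℂ ∋ (σ, μ, ρ)`. It is the space of `ℝ`-linear maps `ℝ ⊕ T_pM ⊕ ℝ → ℂ`, where
`(σ, μ, ρ)` is the map `(s, v, r) ↦ s σ + μ(v) + r ρ`; its `k`-th tensor power is the space of
`k`-linear maps. For `k = 0` this is `ℂ`. -/
abbrev TractorFibre (k : ℕ) (p : M) : Type _ :=
  MultilinearMap ℝ (fun _ : Fin k => ℝ × TangentSpace I p × ℝ) ℂ

/-- The frame of `ℝ ⊕ T_qM ⊕ ℝ` that the chart at `p` gives at the point `q` with coordinates `u`;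
evaluation on it yields the components of tractors. -/
def chartFrame (p : M) (u : EuclideanSpace ℝ (Fin d)) :
    TIdx d → ℝ × TangentSpace I ((extChartAt I p).symm u) × ℝ
  | .inl _ => (1, 0, 0)
  | .inr (.inl a) => (0, coordVec I p u a, 0)
  | .inr (.inr _) => (0, 0, 1)

variable {I}

/-- The components `F_{B_1 … B_k}` in the chart at `p` of a rank `k` tractor field. -/
def chartComp {k : ℕ} (f : ∀ q : M, TractorFibre I k q) (p : M) (u : EuclideanSpace ℝ (Fin d))
    (B : Fin k → TIdx d) : ℂ :=
  f ((extChartAt I p).symm u) fun i => chartFrame I p u (B i)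

variable (I) in
/-- The coordinate functions on `ℝ ⊕ T_pM ⊕ ℝ` for the chart at `p`, at the point `p` itself.
(`TangentSpace I p` is by definition `ℝ^d`, the identification being through the chart at `p`.) -/
def coordAt (p : M) : TIdx d → (ℝ × TangentSpace I p × ℝ) →ₗ[ℝ] ℝ
  | .inl _ => LinearMap.fst ℝ ℝ (TangentSpace I p × ℝ)
  | .inr (.inl a) =>
      (EuclideanSpace.proj a : EuclideanSpace ℝ (Fin d) →L[ℝ] ℝ).toLinearMap ∘ₗ
        LinearMap.fst ℝ (TangentSpace I p) ℝ ∘ₗ LinearMap.snd ℝ ℝ (TangentSpace I p × ℝ)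
  | .inr (.inr _) =>
      LinearMap.snd ℝ (TangentSpace I p) ℝ ∘ₗ LinearMap.snd ℝ ℝ (TangentSpace I p × ℝ)

variable (I) in
/-- The tractor tensor at `p` with given components in the chart at `p`. -/
def ofComponents {k : ℕ} (p : M) (C : (Fin k → TIdx d) → ℂ) : TractorFibre I k p :=
  ∑ B, ((MultilinearMap.mkPiAlgebra ℝ (Fin k) ℝ).compLinearMap
    fun i => coordAt I p (B i)).smulRight (C B)

/-- The change of scale from `g` to `e^{2Υ} g`, written on the arguments `(s, v, r)` of tractors. Here
`t = e^{Υ(p)}`, `η = dΥ(p)` and `N` is the vector `g`-dual to `η`. As functions, in the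
trivialisations of the density bundles belonging to the two metrics,
`(σ, μ, ρ) ↦ (t σ, t (μ + σ η), t⁻¹ (ρ - g⁻¹(η, μ) - ½ σ g⁻¹(η, η)))`. -/
def changeScale {p : M} (t : ℝ) (η : TangentSpace I p → ℝ) (N : TangentSpace I p)
    (T : ℝ × TangentSpace I p × ℝ) : ℝ × TangentSpace I p × ℝ :=
  (t * (T.1 + η T.2.1) - t⁻¹ * T.2.2 * (η N / 2), t • T.2.1 - (t⁻¹ * T.2.2) • N, t⁻¹ * T.2.2)

/-- A rank `k` tractor field on a conformal manifold, through its representatives in all the scales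
`g ∈ c` (no regularity and no compatibility required yet). -/
abbrev TractorField (c : ConformalStructure I M) (k : ℕ) : Type _ :=
  ∀ (_ : c.metrics) (p : M), TractorFibre I k p

/-- `f` is a smooth section of weight `w` of the `k`-th tensor power of the standard tractor bundle:
its representatives are smooth and those in any two scales of `c` are related by the tractor
transformation law. For `k = 0` this is a density of weight `w`, with law `f̂ = e^{wΥ} f`. -/
structure IsSection (c : ConformalStructure I M) {k : ℕ} (w : ℂ) (f : TractorField c k) : Prop where
  smooth : ∀ (g : c.metrics) (p : M) (B : Fin k → TIdx d),
    ContDiffOn ℝ ∞ (fun u => chartComp (f g) p u B) (extChartAt I p).target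
  covariant : ∀ (g g' : c.metrics) (Υ : M → ℝ), IsRescaling g.1 g'.1 Υ →
    ∀ (p : M) (N : TangentSpace I p),
      (∀ X : TangentSpace I p, g.1.val p N X = mfderiv I 𝓘(ℝ, ℝ) Υ p X) →
      ∀ T : Fin k → ℝ × TangentSpace I p × ℝ,
        f g' p T = Complex.exp (w * (Υ p : ℂ)) *
          f g p fun i => changeScale (Real.exp (Υ p)) (mfderiv I 𝓘(ℝ, ℝ) Υ p) N (T i)

/-! ## The Thomas D-operator, the scale tractor and the degenerate Laplacian -/

variable {c : ConformalStructure I M} {k : ℕ}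

/-- The Thomas D-operator `D_A` on fields of weight `w`. -/
def thomasD (w : ℂ) (f : TractorField c k) : TractorField c (k + 1) := fun g p =>
  ofComponents I p
    (thomasDComp I (chartMetric g.1 p) (extChartAt I p p) (chartComp (f g) p) w)

/-- The contraction `V^A F_{A B_1 … B_k}` by the tractor metric. -/
def contract (V : TractorField c 1) (F : TractorField c (k + 1)) : TractorField c k := fun g p =>
  ofComponents I p fun B => ∑ A, ∑ C,
    (tractorMetric (chartMetric g.1 p (extChartAt I p p))⁻¹ A C : ℂ) *
      chartComp (V g) p (extChartAt I p p) (fun _ => A) *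
      chartComp (F g) p (extChartAt I p p) (Fin.cons C B)

/-- The complex number that a field of rank `0` is at a point, in the scale `g`. -/
def scalar (s : TractorField c 0) (g : c.metrics) (p : M) : ℂ := s g p Fin.elim0

/-- The scale tractor `I_A = (1/d) D_A σ` of a density `σ` of weight `1`. -/
def scaleTractor (σ : TractorField c 0) : TractorField c 1 :=
  (1 / (d : ℂ)) • thomasD 1 σ

/-- `I² = I^A I_A`, in the scale `g` and at the point `p`. -/
def scaleTractorSq (σ : TractorField c 0) (g : c.metrics) (p : M) : ℂ :=
  scalar (contract (scaleTractor σ) (scaleTractor σ)) g p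

/-- `I·D = I^A D_A` on fields of weight `w`. -/
def degenerateLaplacian (σ : TractorField c 0) (w : ℂ) (f : TractorField c k) : TractorField c k :=
  contract (scaleTractor σ) (thomasD w f)

/-! ## Operators on weighted tractor fields -/

/-- Weighted tractor fields of rank `k`, of all weights: `F w` is the part of weight `w`. -/
abbrev WeightedField (c : ConformalStructure I M) (k : ℕ) : Type _ := ℂ → TractorField c k

/-- `F` consists of smooth sections: the part `F w` is a section of weight `w`. A single section
`f` of weight `w` is `Pi.single w f`. -/
def IsWeightedSection (F : WeightedField c k) : Prop := ∀ w, IsSection c w (F w)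

/-- `x = σ`, multiplication by `σ`; it raises the weight by one. -/
def opX (σ : TractorField c 0) (F : WeightedField c k) : WeightedField c k :=
  fun w g p => scalar σ g p • F (w - 1) g p

/-- `I·D`; it lowers the weight by one. -/
def opID (σ : TractorField c 0) (F : WeightedField c k) : WeightedField c k :=
  fun w => degenerateLaplacian σ (w + 1) (F (w + 1))

/-- `y = -(1/I²) I·D`. -/
def opY (σ : TractorField c 0) (F : WeightedField c k) : WeightedField c k :=
  fun w g p => -(1 / scaleTractorSq σ g p) • opID σ F w g p

/-- The weight operator: multiplication by `w` on weight `w`. -/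
def opW (F : WeightedField c k) : WeightedField c k := fun w => w • F w

/-- `h = d + 2w`, with `w` the weight operator. -/
def opH (F : WeightedField c k) : WeightedField c k := (d : ℂ) • F + (2 : ℂ) • opW F

/-- The commutator `[A, B] = A ∘ B - B ∘ A`. -/
def comm (A B : WeightedField c k → WeightedField c k) (F : WeightedField c k) :
    WeightedField c k :=
  A (B F) - B (A F)

end Manifold

end ConformalTractor

end

/-!
In a fixed scale write `s` for `σ`, `G` for the metric and `ρ = -(Δs + Js)/d` for the bottom slot of
the scale tractor `I = (s, ds, ρ)`. Contracting with the slots of `D F` gives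
`I·D F = -s (ΔF + wJF) + (d + 2w - 2) (⟨ds, ∇F⟩ + wρF)`, while `I² = ⟨ds, ds⟩ + 2sρ`. The Leibniz
rules for `∇` and `Δ` then show that `I·D (sF) - s (I·D F) = (d + 2w) I² F`, which is
`[I·D, x] = I² h` and contains both the `sl(2)` relation and its contraction.
-/

open scoped Manifold ContDiff Topology

noncomputable section

namespace ConformalTractor

section MatrixSmoothness

variable {𝕜 E ι : Type*} [NontriviallyNormedField 𝕜] [NormedAddCommGroup E] [NormedSpace 𝕜 E]
  [Fintype ι] [DecidableEq ι] {n : WithTop ℕ∞} {A : E → Matrix ι ι 𝕜} {s : Set E} {x : E}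

theorem contDiffWithinAt_matrix_det (hA : ∀ i j, ContDiffWithinAt 𝕜 n (fun y => A y i j) s x) :
    ContDiffWithinAt 𝕜 n (fun y => (A y).det) s x := by
  simp only [Matrix.det_apply']
  exact ContDiffWithinAt.sum fun τ _ =>
    contDiffWithinAt_const.mul (contDiffWithinAt_prod fun i _ => hA _ _)

theorem contDiffWithinAt_matrix_inv (hA : ∀ i j, ContDiffWithinAt 𝕜 n (fun y => A y i j) s x)
    (hdet : (A x).det ≠ 0) (i j : ι) : ContDiffWithinAt 𝕜 n (fun y => (A y)⁻¹ i j) s x := by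
  simp only [Matrix.inv_def, Ring.inverse_eq_inv', Matrix.smul_apply, smul_eq_mul,
    Matrix.adjugate_apply]
  refine ((contDiffWithinAt_matrix_det hA).inv hdet).mul
    (contDiffWithinAt_matrix_det fun k l => ?_)
  by_cases hk : k = j
  · simpa only [Matrix.updateRow_apply, if_pos hk] using contDiffWithinAt_const
  · simpa only [Matrix.updateRow_apply, if_neg hk] using hA k l

end MatrixSmoothness

section CoordinateDerivative

variable {d : ℕ} {H : Type*} [TopologicalSpace H]
  {I : ModelWithCorners ℝ (EuclideanSpace ℝ (Fin d)) H} {u : EuclideanSpace ℝ (Fin d)}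
  {V : Type*} [NormedAddCommGroup V] [NormedSpace ℝ V] {F F' : EuclideanSpace ℝ (Fin d) → V}
  {m n : WithTop ℕ∞}

theorem contDiffWithinAt_pd (hu : u ∈ Set.range I) (hF : ContDiffWithinAt ℝ n F (Set.range I) u)
    (hmn : m + 1 ≤ n) (a : Fin d) : ContDiffWithinAt ℝ m (pd I a F) (Set.range I) u :=
  (hF.fderivWithin_right I.uniqueDiffOn hmn hu).clm_apply contDiffWithinAt_const

theorem pd_congr (hu : u ∈ Set.range I) (h : F =ᶠ[𝓝[Set.range I] u] F') (a : Fin d) :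
    pd I a F u = pd I a F' u := by
  rw [pd, pd, h.fderivWithin_eq_of_mem hu]

theorem pd_add (hu : u ∈ Set.range I) (hF : DifferentiableWithinAt ℝ F (Set.range I) u)
    (hF' : DifferentiableWithinAt ℝ F' (Set.range I) u) (a : Fin d) :
    pd I a (fun v => F v + F' v) u = pd I a F u + pd I a F' u := by
  rw [pd, fderivWithin_fun_add (I.uniqueDiffOn u hu) hF hF']
  rfl

theorem pd_mul {𝔸 : Type*} [NormedCommRing 𝔸] [NormedAlgebra ℝ 𝔸]
    {s t : EuclideanSpace ℝ (Fin d) → 𝔸} (hu : u ∈ Set.range I)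
    (hs : DifferentiableWithinAt ℝ s (Set.range I) u)
    (ht : DifferentiableWithinAt ℝ t (Set.range I) u) (a : Fin d) :
    pd I a (fun v => s v * t v) u = pd I a s u * t u + s u * pd I a t u := by
  rw [pd, fderivWithin_fun_mul (I.uniqueDiffOn u hu) hs ht]
  simp only [pd, add_apply, smul_apply, smul_eq_mul]
  ring

theorem pd_const_mul (hu : u ∈ Set.range I) (z : ℂ) (s : EuclideanSpace ℝ (Fin d) → ℂ)
    (a : Fin d) : pd I a (fun v => z * s v) u = z * pd I a s u :=
  DFunLike.congr_fun (fderivWithin_const_smul_field (f := s) z (I.uniqueDiffOn u hu)) _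

end CoordinateDerivative

section ConnectionSmoothness

variable {d : ℕ} {H : Type*} [TopologicalSpace H]
  {I : ModelWithCorners ℝ (EuclideanSpace ℝ (Fin d)) H} {u : EuclideanSpace ℝ (Fin d)}
  {G : EuclideanSpace ℝ (Fin d) → Matrix (Fin d) (Fin d) ℝ} {m n : WithTop ℕ∞}

theorem contDiffWithinAt_christoffel (hu : u ∈ Set.range I)
    (hG : ∀ a b, ContDiffWithinAt ℝ n (fun v => G v a b) (Set.range I) u)
    (hdet : (G u).det ≠ 0) (hmn : m + 1 ≤ n) (c a b : Fin d) :
    ContDiffWithinAt ℝ m (fun v => christoffel I G v c a b) (Set.range I) u := by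
  have hG' := fun a b e => contDiffWithinAt_pd hu (hG a b) hmn e
  unfold christoffel
  exact contDiffWithinAt_const.mul (ContDiffWithinAt.sum fun e _ =>
    ((contDiffWithinAt_matrix_inv hG hdet c e).of_le (le_self_add.trans hmn)).mul
      (((hG' b e a).add (hG' a e b)).sub (hG' a b e)))

theorem contDiffWithinAt_ricci (hu : u ∈ Set.range I)
    (hG : ∀ a b, ContDiffWithinAt ℝ n (fun v => G v a b) (Set.range I) u)
    (hdet : (G u).det ≠ 0) (hmn : m + 1 + 1 ≤ n) (a b : Fin d) :
    ContDiffWithinAt ℝ m (fun v => ricci I G v a b) (Set.range I) u := by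
  have hΓ := contDiffWithinAt_christoffel hu hG hdet hmn
  have hΓ' := fun c a b => (hΓ c a b).of_le le_self_add
  have h_pdΓ := fun c a b e => contDiffWithinAt_pd hu (hΓ c a b) le_rfl e
  unfold ricci riemann
  exact ContDiffWithinAt.sum fun c _ =>
    ((h_pdΓ _ _ _ _).sub (h_pdΓ _ _ _ _)).add (ContDiffWithinAt.sum fun f _ =>
      ((hΓ' _ _ _).mul (hΓ' _ _ _)).sub ((hΓ' _ _ _).mul (hΓ' _ _ _)))

theorem contDiffWithinAt_schouten (hu : u ∈ Set.range I)
    (hG : ∀ a b, ContDiffWithinAt ℝ n (fun v => G v a b) (Set.range I) u)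
    (hdet : (G u).det ≠ 0) (hmn : m + 1 + 1 ≤ n) (a b : Fin d) :
    ContDiffWithinAt ℝ m (fun v => schouten I G v a b) (Set.range I) u := by
  have hmn' : m ≤ n := (le_self_add.trans le_self_add).trans hmn
  have hRic := contDiffWithinAt_ricci hu hG hdet hmn
  have hJ : ContDiffWithinAt ℝ m (schoutenTrace I G) (Set.range I) u := by
    unfold schoutenTrace scalarCurvature
    exact (ContDiffWithinAt.sum fun a _ => ContDiffWithinAt.sum fun b _ =>
      ((contDiffWithinAt_matrix_inv hG hdet a b).of_le hmn').mul (hRic a b)).div_const _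
  unfold schouten
  exact ((hRic a b).sub (hJ.mul ((hG a b).of_le hmn'))).div_const _

theorem contDiffWithinAt_tractorConn (hu : u ∈ Set.range I)
    (hG : ∀ a b, ContDiffWithinAt ℝ n (fun v => G v a b) (Set.range I) u)
    (hdet : (G u).det ≠ 0) (hmn : m + 1 + 1 ≤ n) (a : Fin d) (B C : TIdx d) :
    ContDiffWithinAt ℝ m (fun v => tractorConn I G v a B C) (Set.range I) u := by
  have hmn' : m ≤ n := (le_self_add.trans le_self_add).trans hmn
  have hP := contDiffWithinAt_schouten hu hG hdet hmn
  rcases B with _ | b | _ <;> rcases C with _ | c | _ <;> simp only [tractorConn]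
  any_goals exact contDiffWithinAt_const
  · exact hP a b
  · exact (contDiffWithinAt_christoffel hu hG hdet (le_self_add.trans hmn) c a b).neg
  · exact (hG a b).of_le hmn'
  · exact (ContDiffWithinAt.sum fun e _ =>
      (hP a e).mul ((contDiffWithinAt_matrix_inv hG hdet e c).of_le hmn')).neg

end ConnectionSmoothness

section LeibnizRules

variable {d : ℕ} {H : Type*} [TopologicalSpace H]
  {I : ModelWithCorners ℝ (EuclideanSpace ℝ (Fin d)) H}
  {G : EuclideanSpace ℝ (Fin d) → Matrix (Fin d) (Fin d) ℝ} {u : EuclideanSpace ℝ (Fin d)}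
  {k : ℕ} {s t : EuclideanSpace ℝ (Fin d) → ℂ}
  {F F' : EuclideanSpace ℝ (Fin d) → (Fin k → TIdx d) → ℂ}

theorem contDiffWithinAt_nabla {m n : WithTop ℕ∞} (hu : u ∈ Set.range I) {a : Fin d}
    (hA : ∀ B C, ContDiffWithinAt ℝ m (fun v => tractorConn I G v a B C) (Set.range I) u)
    (hF : ∀ B, ContDiffWithinAt ℝ n (fun v => F v B) (Set.range I) u) (hmn : m + 1 ≤ n)
    (B : Fin k → TIdx d) :
    ContDiffWithinAt ℝ m (fun v => nabla I G v F a B) (Set.range I) u := by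
  unfold nabla
  exact (contDiffWithinAt_pd hu (hF B) hmn a).add (ContDiffWithinAt.sum fun i _ =>
    ContDiffWithinAt.sum fun C _ =>
      (Complex.ofRealCLM.contDiff.contDiffAt.comp_contDiffWithinAt u (hA (B i) C)).mul
        ((hF _).of_le (le_self_add.trans hmn)))

theorem nabla_congr (hu : u ∈ Set.range I)
    (h : ∀ B, (fun v => F v B) =ᶠ[𝓝[Set.range I] u] fun v => F' v B)
    (a : Fin d) (B : Fin k → TIdx d) : nabla I G u F a B = nabla I G u F' a B := by
  have h_self : ∀ B, F u B = F' u B := fun B => (h B).eq_of_nhdsWithin hu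
  simp only [nabla, h_self, pd_congr hu (h B)]

theorem nabla_add (hu : u ∈ Set.range I)
    (hF : ∀ B, DifferentiableWithinAt ℝ (fun v => F v B) (Set.range I) u)
    (hF' : ∀ B, DifferentiableWithinAt ℝ (fun v => F' v B) (Set.range I) u)
    (a : Fin d) (B : Fin k → TIdx d) :
    nabla I G u (fun v B => F v B + F' v B) a B = nabla I G u F a B + nabla I G u F' a B := by
  simp only [nabla, pd_add hu (hF B) (hF' B), mul_add, Finset.sum_add_distrib]
  ring

theorem nabla_mul (hu : u ∈ Set.range I) (hs : DifferentiableWithinAt ℝ s (Set.range I) u)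
    (hF : ∀ B, DifferentiableWithinAt ℝ (fun v => F v B) (Set.range I) u)
    (a : Fin d) (B : Fin k → TIdx d) :
    nabla I G u (fun v B => s v * F v B) a B
      = pd I a s u * F u B + s u * nabla I G u F a B := by
  simp only [nabla, pd_mul hu hs (hF B), mul_add, Finset.mul_sum, add_assoc, mul_left_comm]

theorem nabla_const_mul (hu : u ∈ Set.range I) (z : ℂ) (a : Fin d) (B : Fin k → TIdx d) :
    nabla I G u (fun v B => z * F v B) a B = z * nabla I G u F a B := by
  simp only [nabla, pd_const_mul hu, mul_add, Finset.mul_sum, mul_left_comm]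

theorem eventually_differentiableWithinAt {n : WithTop ℕ∞} (hu : u ∈ Set.range I)
    (hs : ContDiffWithinAt ℝ n s (Set.range I) u) (hn : 1 ≤ n) :
    ∀ᶠ v in 𝓝[Set.range I] u, DifferentiableWithinAt ℝ s (Set.range I) v := by
  have h := (hs.of_le hn).eventually (by simp)
  rw [Set.insert_eq_of_mem hu] at h
  exact h.mono fun v hv => hv.differentiableWithinAt one_ne_zero

theorem nabla_nabla_mul (hu : u ∈ Set.range I)
    (hA : ∀ a B C, ContDiffWithinAt ℝ 1 (fun v => tractorConn I G v a B C) (Set.range I) u)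
    (hs : ContDiffWithinAt ℝ 2 s (Set.range I) u)
    (hF : ∀ B, ContDiffWithinAt ℝ 2 (fun v => F v B) (Set.range I) u)
    (a b : Fin d) (B : Fin k → TIdx d) :
    nabla I G u (fun v => nabla I G v (fun v B => s v * F v B) b) a B
      = pd I a (pd I b s) u * F u B + pd I b s u * nabla I G u F a B
        + (pd I a s u * nabla I G u F b B
          + s u * nabla I G u (fun v => nabla I G v F b) a B) := by
  have hs₁ := hs.differentiableWithinAt two_ne_zero
  have hF₁ := fun B => (hF B).differentiableWithinAt two_ne_zero
  have h_pd : DifferentiableWithinAt ℝ (pd I b s) (Set.range I) u :=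
    (contDiffWithinAt_pd hu hs one_add_one_eq_two.le b).differentiableWithinAt one_ne_zero
  have h_nabla : ∀ B, DifferentiableWithinAt ℝ (fun v => nabla I G v F b B) (Set.range I) u :=
    fun B => (contDiffWithinAt_nabla hu (hA b) hF one_add_one_eq_two.le B).differentiableWithinAt
      one_ne_zero
  have h_leibniz : ∀ B, (fun v => nabla I G v (fun v B => s v * F v B) b B)
      =ᶠ[𝓝[Set.range I] u] fun v => pd I b s v * F v B + s v * nabla I G v F b B := by
    intro B
    filter_upwards [eventually_differentiableWithinAt hu hs one_le_two,
      Filter.eventually_all.2 fun B => eventually_differentiableWithinAt hu (hF B) one_le_two,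
      self_mem_nhdsWithin] with v hsv hFv hv
    exact nabla_mul hv hsv hFv b B
  rw [nabla_congr hu h_leibniz, nabla_add hu (fun B => h_pd.fun_mul (hF₁ B))
    (fun B => hs₁.fun_mul (h_nabla B)), nabla_mul hu h_pd hF₁, nabla_mul hu hs₁ h_nabla]

/-- A function of the coordinates, as the only component of a tractor tensor of rank `0`. -/
def rankZero (s : EuclideanSpace ℝ (Fin d) → ℂ) (u : EuclideanSpace ℝ (Fin d))
    (_ : Fin 0 → TIdx d) : ℂ := s u

theorem nabla_rankZero (s : EuclideanSpace ℝ (Fin d) → ℂ) (u : EuclideanSpace ℝ (Fin d))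
    (a : Fin d) : nabla I G u (rankZero s) a = rankZero (pd I a s) u := by
  ext B
  simp only [nabla, rankZero, Finset.univ_eq_empty, Finset.sum_empty, add_zero]

variable (I G u s F) in
/-- The contraction `g^{ab} (∂_a s) ∇_b F` of the differential of a function with the tractor
derivative of a tractor tensor. -/
def gradPairing (B : Fin k → TIdx d) : ℂ :=
  ∑ a, ∑ b, ((G u)⁻¹ a b : ℂ) * pd I a s u * nabla I G u F b B

theorem gradPairing_mul (hu : u ∈ Set.range I) (ht : DifferentiableWithinAt ℝ t (Set.range I) u)
    (hF : ∀ B, DifferentiableWithinAt ℝ (fun v => F v B) (Set.range I) u)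
    (B : Fin k → TIdx d) :
    gradPairing I G u s (fun v B => t v * F v B) B
      = gradPairing I G u s (rankZero t) Fin.elim0 * F u B + t u * gradPairing I G u s F B := by
  simp only [gradPairing, nabla_mul hu ht hF, nabla_rankZero, rankZero, Finset.sum_mul,
    Finset.mul_sum, ← Finset.sum_add_distrib]
  exact Finset.sum_congr rfl fun a _ => Finset.sum_congr rfl fun b _ => by ring

theorem gradPairing_swap (hG : (G u).IsSymm) (B : Fin k → TIdx d) :
    ∑ a, ∑ b, ((G u)⁻¹ a b : ℂ) * pd I b s u * nabla I G u F a B = gradPairing I G u s F B := by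
  rw [gradPairing, Finset.sum_comm]
  simp only [hG.inv.apply]

theorem laplacian_mul (hu : u ∈ Set.range I) (hG : (G u).IsSymm)
    (hA : ∀ a B C, ContDiffWithinAt ℝ 1 (fun v => tractorConn I G v a B C) (Set.range I) u)
    (hs : ContDiffWithinAt ℝ 2 s (Set.range I) u)
    (hF : ∀ B, ContDiffWithinAt ℝ 2 (fun v => F v B) (Set.range I) u) (B : Fin k → TIdx d) :
    laplacian I G u (fun v B => s v * F v B) B
      = laplacian I G u (rankZero s) Fin.elim0 * F u B + 2 * gradPairing I G u s F B
        + s u * laplacian I G u F B := by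
  have hs₁ := hs.differentiableWithinAt two_ne_zero
  have hF₁ := fun B => (hF B).differentiableWithinAt two_ne_zero
  rw [two_mul]
  nth_rewrite 1 [← gradPairing_swap hG]
  simp only [laplacian, gradPairing, nabla_nabla_mul hu hA hs hF, nabla_mul hu hs₁ hF₁,
    nabla_rankZero, rankZero, Finset.sum_mul, Finset.mul_sum, ← Finset.sum_add_distrib]
  refine Finset.sum_congr rfl fun a _ => Finset.sum_congr rfl fun b _ => ?_
  have hΓ : ∑ c, (christoffel I G u c a b : ℂ) * (pd I c s u * F u B + s u * nabla I G u F c B)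
      = (∑ c, (christoffel I G u c a b : ℂ) * pd I c s u) * F u B
        + s u * ∑ c, (christoffel I G u c a b : ℂ) * nabla I G u F c B := by
    rw [Finset.sum_mul, Finset.mul_sum, ← Finset.sum_add_distrib]
    exact Finset.sum_congr rfl fun c _ => by ring
  rw [hΓ]
  ring

end LeibnizRules

section CoordinateDegenerateLaplacian

variable {d : ℕ} {H : Type*} [TopologicalSpace H]
  (I : ModelWithCorners ℝ (EuclideanSpace ℝ (Fin d)) H)
  (G : EuclideanSpace ℝ (Fin d) → Matrix (Fin d) (Fin d) ℝ) (u : EuclideanSpace ℝ (Fin d))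
  {k : ℕ} (s : EuclideanSpace ℝ (Fin d) → ℂ) (w : ℂ)
  (F : EuclideanSpace ℝ (Fin d) → (Fin k → TIdx d) → ℂ)

/-- The bottom slot `ρ = -(Δs + Js) / d` of the scale tractor `(s, ds, ρ)` of `s`. -/
def scaleTractorBottom : ℂ :=
  -(1 / (d : ℂ)) *
    (laplacian I G u (rankZero s) Fin.elim0 + (schoutenTrace I G u : ℂ) * s u)

/-- The components of the scale tractor `(s, ds, ρ)` of `s`. -/
def scaleTractorComp : TIdx d → ℂ
  | .inl _ => s u
  | .inr (.inl a) => pd I a s u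
  | .inr (.inr _) => scaleTractorBottom I G u s

/-- The square `I² = ⟨ds, ds⟩ + 2sρ` of the scale tractor of `s`. -/
def scaleTractorSqComp : ℂ :=
  gradPairing I G u s (rankZero s) Fin.elim0 + 2 * s u * scaleTractorBottom I G u s

/-- The components of `I·D F`, for `F` of weight `w` and `I` the scale tractor of `s`. -/
def degenerateLaplacianComp (B : Fin k → TIdx d) : ℂ :=
  -(s u * (laplacian I G u F B + w * (schoutenTrace I G u : ℂ) * F u B))
    + ((d : ℂ) + 2 * w - 2) *
      (gradPairing I G u s F B + w * scaleTractorBottom I G u s * F u B)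

variable {I G u s F}

theorem laplacian_rankZero (hd : d ≠ 0) :
    laplacian I G u (rankZero s) Fin.elim0
      = -(d * scaleTractorBottom I G u s + (schoutenTrace I G u : ℂ) * s u) := by
  have hd' : (d : ℂ) ≠ 0 := Nat.cast_ne_zero.2 hd
  rw [scaleTractorBottom]
  field_simp
  ring

theorem thomasDComp_rankZero (hd : d ≠ 0) (A : Fin 1 → TIdx d) :
    (1 / (d : ℂ)) * thomasDComp I G u (rankZero s) 1 A = scaleTractorComp I G u s (A 0) := by
  have hd' : (d : ℂ) ≠ 0 := Nat.cast_ne_zero.2 hd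
  rw [thomasDComp]
  rcases A 0 with _ | a | _
  · simp only [rankZero, scaleTractorComp]
    field_simp
    ring
  · simp only [nabla_rankZero, rankZero, scaleTractorComp]
    field_simp
    ring
  · simp only [Subsingleton.elim (Fin.tail A) Fin.elim0, rankZero, scaleTractorComp,
      scaleTractorBottom]
    ring

theorem laplacian_const_mul (hu : u ∈ Set.range I) (z : ℂ) (B : Fin k → TIdx d) :
    laplacian I G u (fun v B => z * F v B) B = z * laplacian I G u F B := by
  have h_nabla : ∀ b B, (fun v => nabla I G v (fun v B => z * F v B) b B)
      =ᶠ[𝓝[Set.range I] u] fun v => z * nabla I G v F b B := fun b B =>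
    eventually_nhdsWithin_of_forall fun v hv => nabla_const_mul hv z b B
  simp only [laplacian, nabla_congr hu (h_nabla _), nabla_const_mul hu, Finset.mul_sum, mul_sub,
    mul_left_comm z]

theorem thomasDComp_const_mul (hu : u ∈ Set.range I) (z : ℂ) (A : Fin (k + 1) → TIdx d) :
    thomasDComp I G u (fun v B => z * F v B) w A = z * thomasDComp I G u F w A := by
  rw [thomasDComp, thomasDComp]
  rcases A 0 with _ | a | _ <;> simp only [laplacian_const_mul hu, nabla_const_mul hu] <;> ring

theorem degenerateLaplacianComp_mul (hd : d ≠ 0) (hu : u ∈ Set.range I) (hG : (G u).IsSymm)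
    (hA : ∀ a B C, ContDiffWithinAt ℝ 1 (fun v => tractorConn I G v a B C) (Set.range I) u)
    (hs : ContDiffWithinAt ℝ 2 s (Set.range I) u)
    (hF : ∀ B, ContDiffWithinAt ℝ 2 (fun v => F v B) (Set.range I) u) (B : Fin k → TIdx d) :
    degenerateLaplacianComp I G u s (w + 1) (fun v B => s v * F v B) B
      = s u * degenerateLaplacianComp I G u s w F B
        + (d + 2 * w) * scaleTractorSqComp I G u s * F u B := by
  rw [degenerateLaplacianComp, laplacian_mul hu hG hA hs hF, laplacian_rankZero hd,
    gradPairing_mul hu (hs.differentiableWithinAt two_ne_zero)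
      fun B => (hF B).differentiableWithinAt two_ne_zero,
    degenerateLaplacianComp, scaleTractorSqComp]
  ring

end CoordinateDegenerateLaplacian

section Frames

variable {d : ℕ} {H : Type*} [TopologicalSpace H]
  {I : ModelWithCorners ℝ (EuclideanSpace ℝ (Fin d)) H}
  {M : Type*} [TopologicalSpace M] [ChartedSpace H M] {k : ℕ}

variable (I) in
/-- The basis of `T_pM` given by the chart at `p`, through which `TangentSpace I p` is by definition
`ℝ^d`. -/
def tangentBasis (p : M) : Module.Basis (Fin d) ℝ (TangentSpace I p) :=
  (EuclideanSpace.basisFun (Fin d) ℝ).toBasis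

theorem tangentBasis_apply (p : M) (a : Fin d) :
    tangentBasis I p a = (EuclideanSpace.single a 1 : EuclideanSpace ℝ (Fin d)) :=
  EuclideanSpace.basisFun_apply (Fin d) ℝ a

variable (I) in
/-- The basis of `ℝ ⊕ T_pM ⊕ ℝ` given by the chart at `p`, with coordinate functions `coordAt`. -/
def tractorBasis (p : M) : Module.Basis (TIdx d) ℝ (ℝ × TangentSpace I p × ℝ) :=
  (Module.Basis.singleton Unit ℝ).prod
    ((tangentBasis I p).prod (Module.Basis.singleton Unit ℝ))

theorem tractorBasis_inl (p : M) (x : Unit) : tractorBasis I p (.inl x) = (1, 0, 0) := by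
  simp only [tractorBasis, Module.Basis.prod_apply, Sum.elim_inl, Function.comp_apply,
    Module.Basis.singleton_apply, LinearMap.inl_apply]
  rfl

theorem tractorBasis_inr_inl (p : M) (a : Fin d) :
    tractorBasis I p (.inr (.inl a)) = (0, tangentBasis I p a, 0) := by
  simp [tractorBasis, Module.Basis.prod_apply]

theorem tractorBasis_inr_inr (p : M) (x : Unit) :
    tractorBasis I p (.inr (.inr x)) = (0, 0, 1) := by
  simp [tractorBasis, Module.Basis.prod_apply]

theorem coordAt_tractorBasis (p : M) (A B : TIdx d) :
    coordAt I p A (tractorBasis I p B) = if B = A then 1 else 0 := by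
  have h : coordAt I p A = (tractorBasis I p).coord A := by
    rcases A with _ | a | _
    · exact LinearMap.ext fun T => by
        simp only [coordAt, tractorBasis, Module.Basis.coord_apply, Module.Basis.prod_repr_inl,
          Module.Basis.singleton_repr, LinearMap.fst_apply]
    · rfl
    · exact LinearMap.ext fun T => by
        simp only [coordAt, tractorBasis, Module.Basis.coord_apply, Module.Basis.prod_repr_inr,
          Module.Basis.singleton_repr, LinearMap.coe_comp, Function.comp_apply,
          LinearMap.snd_apply]
  rw [h, Module.Basis.coord_apply, Module.Basis.repr_self, Finsupp.single_apply]

theorem ofComponents_tractorBasis (p : M) (C : (Fin k → TIdx d) → ℂ) (B : Fin k → TIdx d) :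
    ofComponents I p C (fun i => tractorBasis I p (B i)) = C B := by
  simp only [ofComponents, sum_apply, MultilinearMap.smulRight_apply,
    MultilinearMap.compLinearMap_apply, MultilinearMap.mkPiAlgebra_apply, coordAt_tractorBasis,
    Finset.prod_ite_zero, Finset.prod_const_one, Finset.mem_univ, true_imp_iff, ite_smul,
    one_smul, zero_smul]
  simp only [← funext_iff (f := B), Finset.sum_ite_eq, Finset.mem_univ, if_true]

theorem ofComponents_const_smul (p : M) (z : ℂ) (C : (Fin k → TIdx d) → ℂ) :
    ofComponents I p (z • C) = z • ofComponents I p C := by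
  ext T
  simp only [ofComponents, sum_apply, smul_apply, MultilinearMap.smulRight_apply, Pi.smul_apply,
    Finset.smul_sum, smul_comm z]

theorem tractorFibre_ext {p : M} {f f' : TractorFibre I k p}
    (h : ∀ B : Fin k → TIdx d,
      f (fun i => tractorBasis I p (B i)) = f' fun i => tractorBasis I p (B i)) : f = f' :=
  Module.Basis.ext_multilinear (fun _ => tractorBasis I p) h

theorem contDiffWithinAt_extChartAt {V : Type*} [NormedAddCommGroup V] [NormedSpace ℝ V]
    {n : WithTop ℕ∞} {f : EuclideanSpace ℝ (Fin d) → V} (p : M)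
    (hf : ContDiffOn ℝ n f (extChartAt I p).target) :
    ContDiffWithinAt ℝ n f (Set.range I) (extChartAt I p p) :=
  (hf _ (mem_extChartAt_target p)).mono_of_mem_nhdsWithin (extChartAt_target_mem_nhdsWithin p)

theorem chartMetric_isSymm (g : PseudoRiemannianMetric I M) (p : M)
    (u : EuclideanSpace ℝ (Fin d)) : (chartMetric g p u).IsSymm :=
  Matrix.IsSymm.ext fun _ _ => g.symm _ _ _

variable [IsManifold I 1 M]

theorem coordVec_self (p : M) (a : Fin d) :
    coordVec I p (extChartAt I p p) a = tangentBasis I p a := by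
  rw [tangentBasis_apply]
  exact DFunLike.congr_fun (mfderivWithin_range_extChartAt_symm (I := I) (x := p))
    (EuclideanSpace.single a 1 : EuclideanSpace ℝ (Fin d))

-- `(extChartAt I p).symm (extChartAt I p p)` equals `p` only propositionally, so that the frames
-- cannot be compared directly.
theorem apply_chartFrame_self {α : Type*}
    (Φ : ∀ q : M, (TIdx d → ℝ × TangentSpace I q × ℝ) → α) (p : M) :
    Φ _ (chartFrame I p (extChartAt I p p)) = Φ p (tractorBasis I p) := by
  have h_transport : ∀ q : M, q = p → ∀ T : TIdx d → ℝ × TangentSpace I q × ℝ,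
      (T = fun A => tractorBasis I p A) → Φ q T = Φ p (tractorBasis I p) := by
    rintro q rfl T rfl
    rfl
  refine h_transport _ (extChartAt_to_inv p) _ (funext fun A => ?_)
  rcases A with _ | a | _
  · exact (tractorBasis_inl _ _).symm
  · rw [tractorBasis_inr_inl, chartFrame, coordVec_self]
    rfl
  · exact (tractorBasis_inr_inr _ _).symm

theorem chartComp_self (f : ∀ q : M, TractorFibre I k q) (p : M) (B : Fin k → TIdx d) :
    chartComp f p (extChartAt I p p) B = f p fun i => tractorBasis I p (B i) :=
  apply_chartFrame_self (fun q T => f q fun i => T (B i)) p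

theorem chartComp_ofComponents (C : M → (Fin k → TIdx d) → ℂ) (p : M) (B : Fin k → TIdx d) :
    chartComp (fun q => ofComponents I q (C q)) p (extChartAt I p p) B = C p B := by
  rw [chartComp_self, ofComponents_tractorBasis]

theorem chartMetric_self (g : PseudoRiemannianMetric I M) (p : M) :
    chartMetric g p (extChartAt I p p)
      = LinearMap.toMatrix₂ (tangentBasis I p) (tangentBasis I p) (g.val p) := by
  have h := apply_chartFrame_self (I := I) (fun q T => Matrix.of fun a b =>
    g.val q (T (.inr (.inl a))).2.1 (T (.inr (.inl b))).2.1) p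
  refine h.trans ?_
  ext a b
  simp only [Matrix.of_apply, LinearMap.toMatrix₂_apply, tractorBasis_inr_inl]

theorem det_chartMetric_self_ne_zero (g : PseudoRiemannianMetric I M) (p : M) :
    (chartMetric g p (extChartAt I p p)).det ≠ 0 := by
  rw [chartMetric_self]
  exact (LinearMap.separatingLeft_iff_det_ne_zero _).1 (g.nondegenerate p)

end Frames

section DegenerateLaplacian

variable {d : ℕ} {H : Type*} [TopologicalSpace H]
  {I : ModelWithCorners ℝ (EuclideanSpace ℝ (Fin d)) H}
  {M : Type*} [TopologicalSpace M] [ChartedSpace H M]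
  {c : ConformalStructure I M} {k : ℕ} {σ : TractorField c 0} {n : WithTop ℕ∞}

/-- A field of rank `0` in the scale `g`, as a function of the coordinates of the chart at `p`. -/
def chartScalar (σ : TractorField c 0) (g : c.metrics) (p : M)
    (u : EuclideanSpace ℝ (Fin d)) : ℂ :=
  scalar σ g ((extChartAt I p).symm u)

theorem chartComp_eq_rankZero (σ : TractorField c 0) (g : c.metrics) (p : M) :
    chartComp (σ g) p = rankZero (chartScalar σ g p) := by
  ext u B
  exact congrArg (σ g _) (Subsingleton.elim _ _)

theorem chartScalar_self (σ : TractorField c 0) (g : c.metrics) (p : M) :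
    chartScalar σ g p (extChartAt I p p) = scalar σ g p := by
  rw [chartScalar, extChartAt_to_inv]

/-- Tractor fields of class `C^n`: in every scale the components in the charts are `C^n`. Nothing is
required about the dependence on the scale. -/
def ContDiffField (n : WithTop ℕ∞) (f : TractorField c k) : Prop :=
  ∀ (g : c.metrics) (p : M) (B : Fin k → TIdx d),
    ContDiffOn ℝ n (fun u => chartComp (f g) p u B) (extChartAt I p).target

theorem IsSection.contDiffField {w : ℂ} {f : TractorField c k} (hf : IsSection c w f)
    (hn : n ≤ ∞) : ContDiffField n f :=
  fun g p B => (hf.smooth g p B).of_le hn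

theorem ContDiffField.contDiffWithinAt_chartComp {f : TractorField c k} (hf : ContDiffField n f)
    (g : c.metrics) (p : M) (B : Fin k → TIdx d) :
    ContDiffWithinAt ℝ n (fun u => chartComp (f g) p u B) (Set.range I) (extChartAt I p p) :=
  contDiffWithinAt_extChartAt p (hf g p B)

theorem ContDiffField.contDiffWithinAt_chartScalar (hσ : ContDiffField n σ) (g : c.metrics)
    (p : M) : ContDiffWithinAt ℝ n (chartScalar σ g p) (Set.range I) (extChartAt I p p) := by
  have h := hσ.contDiffWithinAt_chartComp g p Fin.elim0
  rwa [chartComp_eq_rankZero] at h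

theorem thomasD_const_smul (w z : ℂ) (f : TractorField c k) :
    thomasD w (z • f) = z • thomasD w f := by
  funext g p
  simp only [thomasD, Pi.smul_apply, ← ofComponents_const_smul]
  congr 1
  exact funext fun A => thomasDComp_const_mul w (Set.mem_range_self _) z A

theorem contract_const_smul (V : TractorField c 1) (z : ℂ) (F : TractorField c (k + 1)) :
    contract V (z • F) = z • contract V F := by
  funext g p
  have h : ∀ u B, chartComp (z • F g) p u B = z * chartComp (F g) p u B := fun _ _ => rfl
  simp only [contract, Pi.smul_apply, ← ofComponents_const_smul, h]
  congr 1
  funext B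
  simp only [Pi.smul_apply, smul_eq_mul, Finset.mul_sum, mul_left_comm]

theorem degenerateLaplacian_const_smul (σ : TractorField c 0) (w z : ℂ) (f : TractorField c k) :
    degenerateLaplacian σ w (z • f) = z • degenerateLaplacian σ w f := by
  rw [degenerateLaplacian, thomasD_const_smul, contract_const_smul, degenerateLaplacian]

theorem contract_tractorBasis (V : TractorField c 1) (F : TractorField c (k + 1))
    (g : c.metrics) (p : M) (B : Fin k → TIdx d) :
    contract V F g p (fun i => tractorBasis I p (B i)) =
      chartComp (V g) p (extChartAt I p p) (fun _ => .inl ()) *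
          chartComp (F g) p (extChartAt I p p) (Fin.cons (.inr (.inr ())) B)
        + (∑ a, ∑ b, ((chartMetric g.1 p (extChartAt I p p))⁻¹ a b : ℂ) *
          chartComp (V g) p (extChartAt I p p) (fun _ => .inr (.inl a)) *
          chartComp (F g) p (extChartAt I p p) (Fin.cons (.inr (.inl b)) B))
        + chartComp (V g) p (extChartAt I p p) (fun _ => .inr (.inr ())) *
          chartComp (F g) p (extChartAt I p p) (Fin.cons (.inl ()) B) := by
  rw [contract, ofComponents_tractorBasis]
  simp [Fintype.sum_sum_type, tractorMetric, add_assoc]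

variable [IsManifold I 1 M]

theorem chartComp_thomasD (w : ℂ) (f : TractorField c k) (g : c.metrics) (p : M)
    (A : Fin (k + 1) → TIdx d) :
    chartComp (thomasD w f g) p (extChartAt I p p) A =
      thomasDComp I (chartMetric g.1 p) (extChartAt I p p) (chartComp (f g) p) w A :=
  chartComp_ofComponents (fun q =>
    thomasDComp I (chartMetric g.1 q) (extChartAt I q q) (chartComp (f g) q) w) p A

theorem chartComp_scaleTractor (hd : d ≠ 0) (σ : TractorField c 0) (g : c.metrics) (p : M)
    (A : Fin 1 → TIdx d) :
    chartComp (scaleTractor σ g) p (extChartAt I p p) A =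
      scaleTractorComp I (chartMetric g.1 p) (extChartAt I p p) (chartScalar σ g p) (A 0) := by
  rw [← thomasDComp_rankZero hd, ← chartComp_eq_rankZero, ← chartComp_thomasD]
  rfl

theorem degenerateLaplacian_tractorBasis (hd : d ≠ 0) (σ : TractorField c 0) (w : ℂ)
    (f : TractorField c k) (g : c.metrics) (p : M) (B : Fin k → TIdx d) :
    degenerateLaplacian σ w f g p (fun i => tractorBasis I p (B i)) =
      degenerateLaplacianComp I (chartMetric g.1 p) (extChartAt I p p) (chartScalar σ g p) w
        (chartComp (f g) p) B := by
  simp only [degenerateLaplacian, contract_tractorBasis, chartComp_scaleTractor hd,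
    chartComp_thomasD, thomasDComp, Fin.cons_zero, Fin.tail_cons, scaleTractorComp,
    degenerateLaplacianComp, gradPairing, mul_add, Finset.mul_sum,
    mul_left_comm _ ((d : ℂ) + 2 * w - 2)]
  ring

theorem scaleTractorSq_eq (hd : d ≠ 0) (σ : TractorField c 0) (g : c.metrics) (p : M) :
    scaleTractorSq σ g p = scaleTractorSqComp I (chartMetric g.1 p) (extChartAt I p p)
      (chartScalar σ g p) := by
  have h : scaleTractorSq σ g p = contract (scaleTractor σ) (scaleTractor σ) g p
      (fun i => tractorBasis I p (Fin.elim0 (α := TIdx d) i)) :=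
    congrArg (contract (scaleTractor σ) (scaleTractor σ) g p) (Subsingleton.elim _ _)
  simp only [h, contract_tractorBasis, chartComp_scaleTractor hd, scaleTractorComp,
    Fin.cons_zero, scaleTractorSqComp, gradPairing, nabla_rankZero, rankZero]
  ring

theorem degenerateLaplacian_smul (hd : d ≠ 0) (hσ : ContDiffField 2 σ) {f : TractorField c k}
    (hf : ContDiffField 2 f) (w : ℂ) (g : c.metrics) (p : M) :
    degenerateLaplacian σ (w + 1) (fun g q => scalar σ g q • f g q) g p
      = scalar σ g p • degenerateLaplacian σ w f g p
        + (((d : ℂ) + 2 * w) * scaleTractorSq σ g p) • f g p := by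
  have hu : extChartAt I p p ∈ Set.range I := Set.mem_range_self _
  have hG : ∀ a b, ContDiffWithinAt ℝ ∞ (fun u => chartMetric g.1 p u a b) (Set.range I)
      (extChartAt I p p) := fun a b => contDiffWithinAt_extChartAt p (g.1.smooth p a b)
  have hA := contDiffWithinAt_tractorConn (m := 1) hu hG (det_chartMetric_self_ne_zero g.1 p)
    (by norm_cast)
  have h_smul : chartComp (fun q => scalar σ g q • f g q) p
      = fun u B => chartScalar σ g p u * chartComp (f g) p u B := rfl
  refine tractorFibre_ext fun B => ?_
  simp only [add_apply, smul_apply, smul_eq_mul, degenerateLaplacian_tractorBasis hd, h_smul,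
    degenerateLaplacianComp_mul w hd hu (chartMetric_isSymm g.1 p _) hA
      (hσ.contDiffWithinAt_chartScalar g p) (hf.contDiffWithinAt_chartComp g p),
    ← scaleTractorSq_eq hd, chartScalar_self, chartComp_self]

end DegenerateLaplacian

section WeightedOperators

variable {d : ℕ} {H : Type*} [TopologicalSpace H]
  {I : ModelWithCorners ℝ (EuclideanSpace ℝ (Fin d)) H}
  {M : Type*} [TopologicalSpace M] [ChartedSpace H M]
  {c : ConformalStructure I M} {k : ℕ} (σ : TractorField c 0) (F : WeightedField c k)

theorem opH_apply (w : ℂ) : opH F w = ((d : ℂ) + 2 * w) • F w := by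
  simp only [opH, opW, Pi.add_apply, Pi.smul_apply, smul_smul, add_smul]

theorem comm_opH_opX : comm opH (opX σ) F = (2 : ℂ) • opX σ F := by
  funext w g p
  simp only [comm, Pi.sub_apply, opH_apply, opX, Pi.smul_apply]
  module

theorem comm_opH_opID : comm opH (opID σ) F = (-2 : ℂ) • opID σ F := by
  funext w g p
  simp only [comm, Pi.sub_apply, opH_apply, opID, Pi.smul_apply, degenerateLaplacian_const_smul]
  module

theorem comm_opH_neg_opID : comm opH (-opID σ) F = (-2 : ℂ) • (-opID σ) F := by
  have h_neg : comm opH (-opID σ) F = -comm opH (opID σ) F := by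
    funext w
    simp only [comm, Pi.sub_apply, Pi.neg_apply, opH_apply]
    module
  rw [h_neg, comm_opH_opID, Pi.neg_apply, smul_neg]

theorem comm_opH_opY : comm opH (opY σ) F = (-2 : ℂ) • opY σ F := by
  funext w g p
  have h := congrFun (congrFun (congrFun (comm_opH_opID σ F) w) g) p
  simp only [comm, Pi.sub_apply, opH_apply, Pi.smul_apply, opY] at h ⊢
  rw [smul_comm, ← smul_sub, h, smul_comm]

variable {σ F} [IsManifold I 1 M]

theorem comm_opID_opX (hd : d ≠ 0) (hσ : ContDiffField 2 σ) (hF : ∀ w, ContDiffField 2 (F w))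
    (w : ℂ) (g : c.metrics) (p : M) :
    comm (opID σ) (opX σ) F w g p = scaleTractorSq σ g p • opH F w g p := by
  have h_opX : opX σ F (w + 1) = fun g q => scalar σ g q • F w g q := by
    funext g q
    rw [opX, add_sub_cancel_right]
  rw [comm, Pi.sub_apply, Pi.sub_apply, Pi.sub_apply, opID, h_opX,
    degenerateLaplacian_smul hd hσ (hF w), opX, opID, sub_add_cancel, add_sub_cancel_left,
    opH_apply, mul_comm, mul_smul]
  rfl

theorem comm_opX_neg_opID (hd : d ≠ 0) (hσ : ContDiffField 2 σ)
    (hF : ∀ w, ContDiffField 2 (F w)) (w : ℂ) (g : c.metrics) (p : M) :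
    comm (opX σ) (-opID σ) F w g p = scaleTractorSq σ g p • opH F w g p := by
  rw [← comm_opID_opX hd hσ hF]
  simp only [comm, Pi.sub_apply, Pi.neg_apply]
  simp only [opX, Pi.neg_apply]
  module

theorem comm_opX_opY (hd : d ≠ 0) (hσ : ContDiffField 2 σ) (hF : ∀ w, ContDiffField 2 (F w))
    (hI : ∀ g p, scaleTractorSq σ g p ≠ 0) : comm (opX σ) (opY σ) F = opH F := by
  funext w g p
  have h_opY : comm (opX σ) (opY σ) F w g p
      = (1 / scaleTractorSq σ g p) • comm (opX σ) (-opID σ) F w g p := by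
    simp only [comm, Pi.sub_apply, Pi.neg_apply, opY]
    simp only [opX, opY, Pi.neg_apply]
    module
  rw [h_opY, comm_opX_neg_opID hd hσ hF, smul_smul, one_div_mul_cancel (hI g p), one_smul]

end WeightedOperators

end ConformalTractor

end

open ConformalTractor in
theorem proposition3p3_general {d : ℕ} (hd : 3 ≤ d) {H : Type*} [TopologicalSpace H]
    (I : ModelWithCorners ℝ (EuclideanSpace ℝ (Fin d)) H)
    {M : Type*} [TopologicalSpace M] [ChartedSpace H M] [IsManifold I 1 M]
    (c : ConformalStructure I M) (σ : TractorField c 0) (hσ : ContDiffField 2 σ) :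
    ((∀ g p, scaleTractorSq σ g p ≠ 0) →
      ∀ (k : ℕ) (F : WeightedField c k), (∀ w, ContDiffField 2 (F w)) →
        comm opH (opX σ) F = (2 : ℂ) • opX σ F ∧
        comm opH (opY σ) F = (-2 : ℂ) • opY σ F ∧
        comm (opX σ) (opY σ) F = opH F) ∧
    ((∀ g p, scaleTractorSq σ g p = 0) →
      ∀ (k : ℕ) (F : WeightedField c k), (∀ w, ContDiffField 2 (F w)) →
        comm opH (opX σ) F = (2 : ℂ) • opX σ F ∧
        comm opH (-opID σ) F = (-2 : ℂ) • (-opID σ) F ∧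
        comm (opX σ) (-opID σ) F = 0) := by
  have hd₀ : d ≠ 0 := by lia
  refine ⟨fun hI k F hF => ⟨comm_opH_opX σ F, comm_opH_opY σ F, comm_opX_opY hd₀ hσ hF hI⟩,
    fun hI k F hF => ⟨comm_opH_opX σ F, comm_opH_neg_opID σ F, ?_⟩⟩
  funext w g p
  rw [comm_opX_neg_opID hd₀ hσ hF, hI, zero_smul]
  rfl

open scoped Manifold ContDiff in
open ConformalTractor in
theorem proposition3p3 {d : ℕ} (hd : 3 ≤ d) {H : Type*} [TopologicalSpace H]
    (I : ModelWithCorners ℝ (EuclideanSpace ℝ (Fin d)) H)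
    {M : Type*} [TopologicalSpace M] [ChartedSpace H M] [IsManifold I ∞ M]
    (c : ConformalStructure I M) (σ : TractorField c 0) (hσ : IsSection c 1 σ) :
    ((∀ g p, scaleTractorSq σ g p ≠ 0) →
      ∀ (k : ℕ) (F : WeightedField c k), IsWeightedSection F →
        comm opH (opX σ) F = (2 : ℂ) • opX σ F ∧
        comm opH (opY σ) F = (-2 : ℂ) • opY σ F ∧
        comm (opX σ) (opY σ) F = opH F) ∧
    ((∀ g p, scaleTractorSq σ g p = 0) →
      ∀ (k : ℕ) (F : WeightedField c k), IsWeightedSection F →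
        comm opH (opX σ) F = (2 : ℂ) • opX σ F ∧
        comm opH (-opID σ) F = (-2 : ℂ) • (-opID σ) F ∧
        comm (opX σ) (-opID σ) F = 0) := by
  have h₂ : (2 : WithTop ℕ∞) ≤ ∞ := by norm_cast
  have h := proposition3p3_general hd I c σ (hσ.contDiffField h₂)
  exact ⟨fun hI k F hF => h.1 hI k F fun w => (hF w).contDiffField h₂,
    fun hI k F hF => h.2 hI k F fun w => (hF w).contDiffField h₂⟩
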